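/- **Theorem 4.1 (Lai).** A non-increasing sequence $\pi=(d_1,\dots,d_n)$ of nonnegative integers is *graphic* if it is the degree sequence of a simple graph of order $n$ (a *realization* of $\pi$), and it is *potentially $H$-graphic* if some realization of $\pi$ contains $H$ as a (not necessarily induced) subgraph; $\sigma(\pi)$ denotes the sum of its terms. Let $\sigma(H,n)$ be the smallest even integer $l\ge 0$ such that every $n$-term graphic sequence $\pi$ of positive integers with $\sigma(\pi)\ge l$ is potentially $H$-graphic. Let $K_5-P_3$ be the graph obtained from the complete graph $K_5$ by removing the three edges of a path $P_3$ on four of its vertices. Then for every $n\ge 5$, $$\sigma(K_5-P_3,\,n)=4n-4 .$$ Moreover, every $n$-term graphic sequence $\pi$ (zero terms allowed) with $\sigma(\pi)\ge 4n-4$ is potentially $K_5-P_3$-graphic, and the sequence $((n-1)^2,2^{n-2})$, that is, $n-1$ taken twice followed by $2$ taken $n-2$ times, is graphic, has positive terms and sum $4n-6$, and is not potentially $K_5-P_3$-graphic. -/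

import Mathlib

namespace PotentiallyGraphic

/-- `G`, a simple graph of order `n`, is a realization of the sequence `d`: its degrees,
in the order of its vertices, are the terms of `d`. -/
def IsRealization {n : ℕ} (G : SimpleGraph (Fin n)) (d : Fin n → ℕ) : Prop :=
  ∀ i, (G.neighborSet i).ncard = d i

/-- A graphic sequence: a non-increasing sequence of `n` nonnegative integers that is the
degree sequence of a simple graph of order `n`. -/
def IsGraphic {n : ℕ} (d : Fin n → ℕ) : Prop :=
  Antitone d ∧ ∃ G : SimpleGraph (Fin n), IsRealization G d

/-- A graphic sequence is potentially `H`-graphic if some realization of it contains `H`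
as a (not necessarily induced) subgraph. -/
def IsPotentially {V : Type*} (H : SimpleGraph V) {n : ℕ} (d : Fin n → ℕ) : Prop :=
  Antitone d ∧ ∃ G : SimpleGraph (Fin n), IsRealization G d ∧ H.IsContained G

/-- The even numbers `l` such that every positive graphic sequence with `n` terms and sum at
least `l` is potentially `H`-graphic. The number `σ(H, n)` is the least element of this set. -/
def sigmaSet {V : Type*} (H : SimpleGraph V) (n : ℕ) : Set ℕ :=
  {l | Even l ∧ ∀ d : Fin n → ℕ, IsGraphic d → (∀ i, 0 < d i) → l ≤ ∑ i, d i →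
    IsPotentially H d}

/-- `s = σ(H, n)`. -/
def IsSigma {V : Type*} (H : SimpleGraph V) (n s : ℕ) : Prop :=
  IsLeast (sigmaSet H n) s

/-- The path `0 - 1 - 2 - 3` with three edges (and four vertices), on the vertices of `K₅`. -/
def pathThree : SimpleGraph (Fin 5) :=
  SimpleGraph.fromEdgeSet {s(0, 1), s(1, 2), s(2, 3)}

/-- `K₅ - P₃`: the complete graph on five vertices with the three edges of a path removed. -/
def K5MinusP3 : SimpleGraph (Fin 5) :=
  (⊤ : SimpleGraph (Fin 5)).deleteEdges pathThree.edgeSet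

/-- The sequence `((n-1)², 2ⁿ⁻²)`. -/
def extremalSeq (n : ℕ) : Fin n → ℕ :=
  fun i => if (i : ℕ) < 2 then n - 1 else 2

end PotentiallyGraphic

namespace PotentiallyGraphic

open Finset

/-! `K5MinusP3` is the gem: vertex `4` joined to all of the path 2 - 0 - 3 - 1.

Upper bound: induct on the number of vertices, deleting a vertex of least degree `δ`, rearranging
the rest, and restoring the vertex with its old neighbours. The bound `4 * #S - 4` survives unless
`δ = 3` and the degree sum is exactly `4 * #S - 4`. For that case
`exists_realization_with_spare_edge` builds a realization directly, growing the wheel on five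
vertices by subdividing an edge that the gem does not use. On five vertices the degree sum alone
forces a gem (`K5MinusP3_isContained_of_sum_ge`).

Lower bound: in any realization of `extremalSeq n` two vertices cover all edges, whereas a vertex
cover of the gem needs three. -/

lemma K5MinusP3_adj {i j : Fin 5} : K5MinusP3.Adj i j ↔
    i ≠ j ∧ (i = 4 ∨ j = 4 ∨ s(i, j) = s(2, 0) ∨ s(i, j) = s(0, 3) ∨ s(i, j) = s(3, 1)) := by
  simp only [K5MinusP3, pathThree, SimpleGraph.deleteEdges_adj, SimpleGraph.top_adj,
    SimpleGraph.edgeSet_fromEdgeSet]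
  simp only [Set.mem_sdiff, Set.mem_insert_iff, Set.mem_singleton_iff, Sym2.mem_diagSet]
  revert i j
  decide

lemma K5MinusP3_isContained_of_path {V : Type*} {G : SimpleGraph V} {v a b c d : V}
    (hva : G.Adj v a) (hvb : G.Adj v b) (hvc : G.Adj v c) (hvd : G.Adj v d)
    (hab : G.Adj a b) (hbc : G.Adj b c) (hcd : G.Adj c d)
    (hac : a ≠ c) (had : a ≠ d) (hbd : b ≠ d) : K5MinusP3.IsContained G := by
  -- The path 2 - 0 - 3 - 1 is sent to `a`, `b`, `c`, `d`, and the hub `4` to `v`.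
  refine ⟨⟨⟨![b, d, a, c, v], ?_⟩, ?_⟩⟩
  · intro i j h
    rw [K5MinusP3_adj] at h
    fin_cases i <;> fin_cases j <;> simp at h ⊢ <;> first | assumption | (symm; assumption)
  · intro i j h
    have := hva.ne; have := hvb.ne; have := hvc.ne; have := hvd.ne
    have := hab.ne; have := hbc.ne; have := hcd.ne
    fin_cases i <;> fin_cases j <;> simp at h ⊢ <;> simp_all

/-! ### Degrees after adding or deleting an edge; enumerations of five points -/

lemma ncard_neighborSet_sup_edge {V : Type*} [Finite V] [DecidableEq V] {G : SimpleGraph V}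
    {u v : V} (huv : u ≠ v) (h : ¬ G.Adj u v) (i : V) :
    ((G ⊔ SimpleGraph.edge u v).neighborSet i).ncard =
      (G.neighborSet i).ncard + (if i = u then 1 else 0) + (if i = v then 1 else 0) := by
  by_cases hu : i = u
  · subst hu
    have : (G ⊔ SimpleGraph.edge i v).neighborSet i = insert v (G.neighborSet i) := by
      ext w
      simp [SimpleGraph.edge_adj]
      grind
    rw [this, Set.ncard_insert_of_notMem (by simpa using h)]
    simp [huv]
  by_cases hv : i = v
  · subst hv
    have : (G ⊔ SimpleGraph.edge u i).neighborSet i = insert u (G.neighborSet i) := by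
      ext w
      simp [SimpleGraph.edge_adj]
      grind
    rw [this, Set.ncard_insert_of_notMem (by simpa [SimpleGraph.adj_comm] using h)]
    simp [hu]
  · have : (G ⊔ SimpleGraph.edge u v).neighborSet i = G.neighborSet i := by
      ext w
      simp [SimpleGraph.edge_adj]
      grind
    simp [this, hu, hv]

lemma ncard_neighborSet_deleteEdge {V : Type*} [Finite V] [DecidableEq V] {G : SimpleGraph V}
    {u v : V} (h : G.Adj u v) (i : V) :
    (G.neighborSet i).ncard = ((G.deleteEdges {s(u, v)}).neighborSet i).ncard +
      (if i = u then 1 else 0) + (if i = v then 1 else 0) := by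
  rw [← ncard_neighborSet_sup_edge h.ne (by simp)]
  congr 2
  ext a b
  simp [SimpleGraph.edge_adj]
  have := h.symm
  have := h.ne
  grind

/-- Five-element sets can be enumerated with a prescribed last element and so that a
prescribed point is not at positions `1` and `2`. -/
lemma exists_enumeration_five {V : Type*} [DecidableEq V] {S : Finset V} (hS : #S = 5) {v : V}
    (hv : v ∈ S) (c : V) :
    ∃ f : Fin 5 ↪ V, univ.map f = S ∧ f 4 = v ∧ f 1 ≠ c ∧ f 2 ≠ c := by
  obtain ⟨g, hg⟩ : ∃ g : Fin 5 ↪ V, univ.map g = S := by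
    refine ⟨(S.equivFinOfCardEq hS).symm.toEmbedding.trans (Function.Embedding.subtype _), ?_⟩
    ext a
    simp only [mem_map, mem_univ, true_and]
    constructor
    · rintro ⟨i, rfl⟩
      exact ((S.equivFinOfCardEq hS).symm i).2
    · intro ha
      exact ⟨S.equivFinOfCardEq hS ⟨a, ha⟩, by simp⟩
  have key : ∀ (σ : Equiv.Perm (Fin 5)) (h : Fin 5 ↪ V), univ.map h = S →
      univ.map (σ.toEmbedding.trans h) = S := fun σ h hh => by
    rw [← Finset.map_map]
    simp [hh]
  obtain ⟨k, -, hk⟩ : ∃ k ∈ (univ : Finset (Fin 5)), g k = v := by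
    rw [← hg] at hv
    simpa using hv
  obtain ⟨h, hh, h4⟩ : ∃ h : Fin 5 ↪ V, univ.map h = S ∧ h 4 = v :=
    ⟨_, key (Equiv.swap 4 k) g hg, by simp [hk]⟩
  by_cases hc : h 1 ≠ c ∧ h 2 ≠ c
  · exact ⟨h, hh, h4, hc⟩
  -- Positions `1`, `2` trade places with `3`, `0`; by injectivity `c` occupies only one position.
  · refine ⟨_, key ((Equiv.swap 0 2).trans (Equiv.swap 1 3)) h hh, h4, ?_, ?_⟩
    · change h 3 ≠ c
      rintro rfl
      simp at hc
    · change h 0 ≠ c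
      rintro rfl
      simp at hc

/-! ### The exceptional sequences -/

lemma ncard_neighborSet_map {V W : Type*} (G : SimpleGraph V) (f : V ↪ W) (i : V) :
    ((G.map f).neighborSet (f i)).ncard = (G.neighborSet i).ncard := by
  have : (G.map f).neighborSet (f i) = f '' G.neighborSet i := by
    ext w
    simp
  rw [this, Set.ncard_image_of_injective _ f.injective]

/-- A sequence of terms at least `3` on `S` with sum `4 |S| - 4` has a realization that contains
`K₅ - P₃` and, outside of it, an edge that avoids a prescribed point. -/
lemma exists_realization_with_spare_edge {V : Type*} [Finite V] [DecidableEq V] :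
    ∀ (m : ℕ) (S : Finset V), #S = m + 5 → ∀ d : V → ℕ, (∀ i ∉ S, d i = 0) →
      (∀ i ∈ S, 3 ≤ d i) → ∑ i ∈ S, d i + 4 = 4 * #S → ∀ c : V,
      ∃ (G : SimpleGraph V) (y z : V), (∀ i, (G.neighborSet i).ncard = d i) ∧ G.Adj y z ∧
        y ≠ c ∧ z ≠ c ∧ K5MinusP3.IsContained (G.deleteEdges {s(y, z)}) := by
  intro m
  induction m with
  | zero =>
    intro S hS d hd0 hd3 hsum c
    obtain ⟨v, hv, hv4⟩ : ∃ v ∈ S, 4 ≤ d v := by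
      by_contra! h
      have : ∑ i ∈ S, d i ≤ #S • 3 := Finset.sum_le_card_nsmul S _ 3 fun i hi => by
        have := h i hi
        omega
      simp only [smul_eq_mul] at this
      omega
    obtain ⟨f, hf, hf4, hf1, hf2⟩ := exists_enumeration_five hS hv c
    have hmem : ∀ i, f i ∈ S := fun i => by simp [← hf]
    have hsum' : ∑ i, d (f i) = 16 := by
      rw [← hf, Finset.sum_map] at hsum
      simp at hsum
      omega
    have hnadj : ¬ (K5MinusP3.map f).Adj (f 1) (f 2) := by
      rw [SimpleGraph.map_adj_apply, K5MinusP3_adj]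
      decide
    have hne : f 1 ≠ f 2 := by simp
    -- Five terms, each at least 3 and one at least 4, with sum 16, must be 4, 3, 3, 3, 3. Joining
    -- the ends `f 1`, `f 2` of the gem's path gives the wheel with these degrees; that rim edge is
    -- the spare one.
    refine ⟨K5MinusP3.map f ⊔ SimpleGraph.edge (f 1) (f 2), f 1, f 2, ?_, ?_, hf1, hf2, ?_⟩
    · intro i
      rw [ncard_neighborSet_sup_edge hne hnadj]
      by_cases hi : i ∈ S
      · obtain ⟨j, rfl⟩ : ∃ j, f j = i := by simpa [← hf] using hi
        have hdeg : ∀ j : Fin 5, (K5MinusP3.neighborSet j).ncard = ![3, 2, 2, 3, 4] j := by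
          intro j
          have : K5MinusP3.neighborSet j = (({k | j ≠ k ∧ (j = 4 ∨ k = 4 ∨ s(j, k) = s(2, 0) ∨
              s(j, k) = s(0, 3) ∨ s(j, k) = s(3, 1))} : Finset (Fin 5)) : Set (Fin 5)) := by
            ext k
            simp [K5MinusP3_adj]
          rw [this, Set.ncard_coe_finset]
          clear this
          revert j
          decide
        have h0 := hd3 _ (hmem 0)
        have h1 := hd3 _ (hmem 1)
        have h2 := hd3 _ (hmem 2)
        have h3 := hd3 _ (hmem 3)
        rw [← hf4] at hv4
        simp only [Fin.sum_univ_five] at hsum'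
        rw [ncard_neighborSet_map, hdeg]
        fin_cases j <;> simp <;> omega
      · have : (K5MinusP3.map f).neighborSet i = ∅ := by
          ext w
          simp only [SimpleGraph.mem_neighborSet, SimpleGraph.map_adj, Set.mem_empty_iff_false,
            iff_false]
          rintro ⟨j, k, -, rfl, -⟩
          exact hi (hmem j)
        rw [this, hd0 i hi, if_neg, if_neg]
        · simp
        · rintro rfl
          exact hi (hmem 2)
        · rintro rfl
          exact hi (hmem 1)
    · exact Or.inr (by simp [SimpleGraph.edge_adj])
    · have hcopy : K5MinusP3.IsContained (K5MinusP3.map f) :=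
        ⟨⟨(SimpleGraph.Embedding.map f K5MinusP3).toHom, f.injective⟩⟩
      refine hcopy.mono_right ?_
      intro a b hab
      rw [SimpleGraph.deleteEdges_adj]
      refine ⟨Or.inl hab, ?_⟩
      rintro (h : s(a, b) = s(f 1, f 2))
      rw [Sym2.eq_iff] at h
      rcases h with ⟨rfl, rfl⟩ | ⟨rfl, rfl⟩
      · exact hnadj hab
      · exact hnadj hab.symm
  | succ m ih =>
    intro S hS d hd0 hd3 hsum c
    -- Otherwise all terms except possibly the one at `c` are at least 4, and the sum is at least `4
    -- * #S - 1`.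
    obtain ⟨x, hx, hxc, hx3⟩ : ∃ x ∈ S, x ≠ c ∧ d x = 3 := by
      by_contra! h
      have h1 : ∀ i ∈ S, 4 ≤ d i + if i = c then 1 else 0 := by
        intro i hi
        have := hd3 i hi
        split_ifs with hic
        · omega
        · have := h i hi hic
          omega
      have h2 := Finset.card_nsmul_le_sum S _ 4 h1
      rw [Finset.sum_add_distrib, Finset.sum_ite_eq'] at h2
      simp at h2
      split_ifs at h2 <;> omega
    obtain ⟨b, hb, hb4⟩ : ∃ b ∈ S, 4 ≤ d b := by
      by_contra! h
      have : ∑ i ∈ S, d i ≤ #S • 3 := Finset.sum_le_card_nsmul S _ 3 fun i hi => by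
        have := h i hi
        omega
      simp only [smul_eq_mul] at this
      omega
    have hbx : b ≠ x := by
      rintro rfl
      omega
    -- Dropping `x` and lowering `b` by one costs 4 in the sum, just what one fewer vertex allows,
    -- and keeps the remaining terms at least 3.
    obtain ⟨d', hd'⟩ : ∃ d' : V → ℕ, ∀ i, d i = d' i + (if i = x then 3 else 0) +
        (if i = b then 1 else 0) := by
      refine ⟨fun i => d i - (if i = x then 3 else 0) - (if i = b then 1 else 0), fun i => ?_⟩
      dsimp only
      split_ifs <;> subst_vars <;> omega
    have hd'x : d' x = 0 := by
      have := hd' x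
      simp [hbx.symm] at this
      omega
    -- The prescribed point is now `b`, so that `y`, `z`, `b` are three distinct neighbours for `x`.
    obtain ⟨G, y, z, hG, hyz, hyb, hzb, hgem⟩ := ih (S.erase x)
      (by rw [Finset.card_erase_of_mem hx]; omega) d' (by
        intro i hi
        rw [Finset.mem_erase] at hi
        by_cases hix : i = x
        · rw [hix, hd'x]
        · have := hd' i
          have := hd0 i (by tauto)
          omega) (by
        intro i hi
        rw [Finset.mem_erase] at hi
        have h1 := hd' i
        have h2 := hd3 i hi.2
        rw [if_neg hi.1] at h1
        split_ifs at h1 with hib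
        · subst hib
          omega
        · omega) (by
        have h1 : ∑ i ∈ S, d i = ∑ i ∈ S, d' i + 3 + 1 := by
          simp only [hd', Finset.sum_add_distrib, Finset.sum_ite_eq', hx, hb, if_true]
        have h2 := Finset.add_sum_erase S d' hx
        have h3 := Finset.card_erase_add_one hx
        omega) b
    have hxG : ∀ w, ¬ G.Adj x w := by
      intro w hw
      have := hG x
      rw [hd'x, Set.ncard_eq_zero] at this
      exact (this ▸ hw : w ∈ (∅ : Set V))
    have hxy : x ≠ y := by
      rintro rfl
      exact hxG _ hyz
    have hxz : x ≠ z := by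
      rintro rfl
      exact hxG _ hyz.symm
    have hyz' := hyz.ne
    obtain ⟨G₀, hG₀⟩ : ∃ G₀, G₀ = G.deleteEdges {s(y, z)} := ⟨_, rfl⟩
    have hxG₀ : ∀ w, ¬ G₀.Adj x w := by
      intro w hw
      rw [hG₀, SimpleGraph.deleteEdges_adj] at hw
      exact hxG w hw.1
    -- Subdividing `y z` by `x` preserves the degrees of `y` and `z`; the edge `x b` restores the
    -- unit taken from `b`.
    have hdeg : ∀ i, ((G₀ ⊔ SimpleGraph.edge x y ⊔ SimpleGraph.edge x z ⊔
        SimpleGraph.edge x b).neighborSet i).ncard = d i := by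
      intro i
      rw [ncard_neighborSet_sup_edge hbx.symm, ncard_neighborSet_sup_edge hxz,
        ncard_neighborSet_sup_edge hxy (hxG₀ y), hd', ← hG, ncard_neighborSet_deleteEdge hyz, hG₀]
      · split_ifs <;> omega
      · simp [SimpleGraph.edge_adj, hxG₀]
        grind
      · simp [SimpleGraph.edge_adj, hxG₀]
        grind
    have hle : ∀ w, G.deleteEdges {s(y, z)} ≤ (G₀ ⊔ SimpleGraph.edge x y ⊔ SimpleGraph.edge x z ⊔
        SimpleGraph.edge x b).deleteEdges {s(x, w)} := by
      intro w u v huv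
      rw [← hG₀] at huv
      rw [SimpleGraph.deleteEdges_adj]
      refine ⟨Or.inl (Or.inl (Or.inl huv)), ?_⟩
      rintro (h : s(u, v) = s(x, w))
      rw [Sym2.eq_iff] at h
      rcases h with ⟨rfl, rfl⟩ | ⟨rfl, rfl⟩
      · exact hxG₀ _ huv
      · exact hxG₀ _ huv.symm
    -- Both `x y` and `x z` are unused by the old gem, and at least one of them avoids `c`.
    by_cases hyc : y = c
    · refine ⟨_, x, z, hdeg, ?_, hxc, ?_, hgem.trans (SimpleGraph.IsContained.of_le (hle z))⟩
      · simp [SimpleGraph.edge_adj, hxz]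
      · rw [← hyc]
        exact hyz'.symm
    · refine ⟨_, x, y, hdeg, ?_, hxc, hyc, hgem.trans (SimpleGraph.IsContained.of_le (hle y))⟩
      simp [SimpleGraph.edge_adj, hxy]

/-! ### Rearranging an arbitrary graph -/

lemma even_sum_ncard_neighborSet {V : Type*} [Fintype V] (G : SimpleGraph V) :
    Even (∑ i, (G.neighborSet i).ncard) := by
  classical
  have : ∀ i, (G.neighborSet i).ncard = G.degree i := fun i => by
    rw [Set.ncard_eq_toFinset_card', ← SimpleGraph.card_neighborFinset_eq_degree]
    rfl
  simp only [this, G.sum_degrees_eq_twice_card_edges]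
  exact even_two_mul _

lemma ncard_neighborSet_eq_sum {V : Type*} [Finite V] {G : SimpleGraph V} [DecidableRel G.Adj]
    {S : Finset V} {i : V} (h : ∀ j, G.Adj i j → j ∈ S) :
    (G.neighborSet i).ncard = ∑ j ∈ S, if G.Adj i j then 1 else 0 := by
  have : G.neighborSet i = ({j ∈ S | G.Adj i j} : Finset V) := by
    ext j
    simpa using h j
  rw [this, Set.ncard_coe_finset, Finset.card_filter]

/-- Since 5 · 3 < 16, some vertex is joined to the other four. At least 8 - 4 = 4 edges remain among
those four, and a graph with four edges on four vertices contains a 4-cycle or is a triangle with a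
pendant edge, so it has a Hamiltonian path. -/
lemma K5MinusP3_isContained_of_sum_ge {V : Type*} [Finite V] {G : SimpleGraph V} {S : Finset V}
    (hS : #S = 5) (hG : ∀ i j, G.Adj i j → j ∈ S)
    (hsum : 16 ≤ ∑ i ∈ S, (G.neighborSet i).ncard) : K5MinusP3.IsContained G := by
  classical
  obtain ⟨v, hv, hv4⟩ : ∃ v ∈ S, 4 ≤ (G.neighborSet v).ncard := by
    by_contra! h
    have : ∑ i ∈ S, (G.neighborSet i).ncard ≤ #S • 3 :=
      Finset.sum_le_card_nsmul S _ 3 fun i hi => by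
        have := h i hi
        omega
    simp only [smul_eq_mul] at this
    omega
  obtain ⟨f, hf, hf4, -, -⟩ := exists_enumeration_five hS hv v
  have hdeg : ∀ i, (G.neighborSet i).ncard = ∑ j, if G.Adj i (f j) then 1 else 0 := by
    intro i
    rw [ncard_neighborSet_eq_sum (hG i), ← hf, Finset.sum_map]
  rw [← hf, Finset.sum_map] at hsum
  rw [← hf4] at hv4
  have e04 := G.adj_comm (f 0) (f 4)
  have e14 := G.adj_comm (f 1) (f 4)
  have e24 := G.adj_comm (f 2) (f 4)
  have e34 := G.adj_comm (f 3) (f 4)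
  have e10 := G.adj_comm (f 1) (f 0)
  have e20 := G.adj_comm (f 2) (f 0)
  have e30 := G.adj_comm (f 3) (f 0)
  have e21 := G.adj_comm (f 2) (f 1)
  have e31 := G.adj_comm (f 3) (f 1)
  have e32 := G.adj_comm (f 3) (f 2)
  simp only [hdeg, Fin.sum_univ_five, SimpleGraph.irrefl, if_false, add_zero, zero_add, e04, e14,
    e24, e34, e10, e20, e30, e21, e31, e32] at hsum hv4
  have hv : G.Adj (f 4) (f 0) ∧ G.Adj (f 4) (f 1) ∧ G.Adj (f 4) (f 2) ∧ G.Adj (f 4) (f 3) := by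
    clear hsum hdeg
    refine ⟨?_, ?_, ?_, ?_⟩ <;>
    · by_contra h
      simp only [h, if_false] at hv4
      split_ifs at hv4 <;> omega
  obtain ⟨h0, h1, h2, h3⟩ := hv
  simp only [h0, h1, h2, h3, if_true] at hsum
  have path : ∀ a b c d : Fin 5, G.Adj (f 4) (f a) → G.Adj (f 4) (f b) → G.Adj (f 4) (f c) →
      G.Adj (f 4) (f d) → G.Adj (f a) (f b) → G.Adj (f b) (f c) → G.Adj (f c) (f d) →
      a ≠ c ∧ a ≠ d ∧ b ≠ d → K5MinusP3.IsContained G := fun a b c d ha hb hc hd hab hbc hcd h =>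
    K5MinusP3_isContained_of_path ha hb hc hd hab hbc hcd (f.injective.ne h.1)
      (f.injective.ne h.2.1) (f.injective.ne h.2.2)
  -- The twelve Hamiltonian paths on four vertices, up to reversal.
  have p0123 := path 0 1 2 3 h0 h1 h2 h3
  have p0132 := path 0 1 3 2 h0 h1 h3 h2
  have p0213 := path 0 2 1 3 h0 h2 h1 h3
  have p0231 := path 0 2 3 1 h0 h2 h3 h1
  have p0312 := path 0 3 1 2 h0 h3 h1 h2
  have p0321 := path 0 3 2 1 h0 h3 h2 h1
  have p1023 := path 1 0 2 3 h1 h0 h2 h3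
  have p1032 := path 1 0 3 2 h1 h0 h3 h2
  have p1203 := path 1 2 0 3 h1 h2 h0 h3
  have p1302 := path 1 3 0 2 h1 h3 h0 h2
  have p2013 := path 2 0 1 3 h2 h0 h1 h3
  have p2103 := path 2 1 0 3 h2 h1 h0 h3
  simp [e10, e21, e31, e32] at p0123 p0132 p0213 p0231 p0312 p0321 p1023 p1032
  simp [e10, e20, e30, e21] at p1203 p1302 p2013 p2103
  clear path hdeg hf hG hS hv hv4 e04 e14 e24 e34 e10 e20 e30 e21 e31 e32
  by_cases a01 : G.Adj (f 0) (f 1) <;> by_cases a02 : G.Adj (f 0) (f 2) <;>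
  by_cases a03 : G.Adj (f 0) (f 3) <;> by_cases a12 : G.Adj (f 1) (f 2) <;>
  by_cases a13 : G.Adj (f 1) (f 3) <;> by_cases a23 : G.Adj (f 2) (f 3) <;>
  simp only [a01, a02, a03, a12, a13, a23, if_true, if_false, forall_const] at * <;>
  first | assumption | omega

/-- Every graph on `S` whose degree sum is at least `4 |S| - 4` can be rearranged, keeping all
degrees, to contain `K₅ - P₃`. -/
lemma exists_same_degrees_K5MinusP3_isContained {V : Type*} [Fintype V] [DecidableEq V] :
    ∀ (m : ℕ) (S : Finset V), #S = m + 5 → ∀ G : SimpleGraph V, (∀ i j, G.Adj i j → j ∈ S) →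
      4 * #S ≤ ∑ i ∈ S, (G.neighborSet i).ncard + 4 →
      ∃ G' : SimpleGraph V, (∀ i, (G'.neighborSet i).ncard = (G.neighborSet i).ncard) ∧
        K5MinusP3.IsContained G' := by
  intro m
  induction m with
  | zero =>
    intro S hS G hG hsum
    exact ⟨G, fun _ => rfl, K5MinusP3_isContained_of_sum_ge hS hG (by omega)⟩
  | succ m ih =>
    intro S hS G hG hsum
    classical
    have hzero : ∀ i ∉ S, (G.neighborSet i).ncard = 0 := by
      intro i hi
      rw [Set.ncard_eq_zero]
      ext j
      simpa using fun h => hi (hG _ _ h.symm)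
    by_cases hexact : (∀ i ∈ S, 3 ≤ (G.neighborSet i).ncard) ∧
        ∑ i ∈ S, (G.neighborSet i).ncard + 4 = 4 * #S
    · obtain ⟨v, -⟩ : S.Nonempty := by
        rw [← Finset.card_pos]
        omega
      obtain ⟨G', y, z, hG', -, -, -, hgem⟩ := exists_realization_with_spare_edge (m + 1) S hS _
        hzero hexact.1 hexact.2 v
      exact ⟨G', hG', hgem.mono_right (SimpleGraph.deleteEdges_le _)⟩
    obtain ⟨v, hv, hmin⟩ := Finset.exists_min_image S (fun i => (G.neighborSet i).ncard)
      (by rw [← Finset.card_pos]; omega)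
    have hcard := Finset.card_erase_add_one hv
    -- The degree sum drops by twice the least degree `δ`. For `δ ≤ 2` this is at most 4. For `δ =
    -- 3`, parity gives two units of slack once equality is excluded. For `δ ≥ 4`, the sum is at
    -- least `#S * δ`, which suffices.
    have hsum' : 4 * #(S.erase v) + 2 * (G.neighborSet v).ncard ≤
        ∑ i ∈ S, (G.neighborSet i).ncard + 4 := by
      have heven : Even (∑ i ∈ S, (G.neighborSet i).ncard) := by
        rw [Finset.sum_subset (Finset.subset_univ S) fun i _ hi => hzero i hi]
        exact even_sum_ncard_neighborSet G
      have hlow : #S • (G.neighborSet v).ncard ≤ ∑ i ∈ S, (G.neighborSet i).ncard :=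
        Finset.card_nsmul_le_sum S _ _ hmin
      rw [smul_eq_mul] at hlow
      obtain ⟨k, hk⟩ := heven
      rcases lt_trichotomy (G.neighborSet v).ncard 3 with h | h | h
      · omega
      · have : ∑ i ∈ S, (G.neighborSet i).ncard + 4 ≠ 4 * #S := fun h' =>
          hexact ⟨fun i hi => h ▸ hmin i hi, h'⟩
        omega
      · have : 4 ≤ (G.neighborSet v).ncard := h
        rw [hS] at hlow
        have := Nat.mul_le_mul_left (m + 4) this
        have h6 : (m + 1 + 5) * (G.neighborSet v).ncard = (m + 4) * (G.neighborSet v).ncard +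
          2 * (G.neighborSet v).ncard := by ring
        omega
    obtain ⟨G₁, hG₁⟩ : ∃ G₁ : SimpleGraph V, ∀ i j, G₁.Adj i j ↔ G.Adj i j ∧ i ≠ v ∧ j ≠ v :=
      ⟨⟨fun i j => G.Adj i j ∧ i ≠ v ∧ j ≠ v, ⟨fun i j h => ⟨h.1.symm, h.2.2, h.2.1⟩⟩,
        ⟨fun i h => h.1.ne rfl⟩⟩, fun i j => Iff.rfl⟩
    have hjoin : ∀ H : SimpleGraph V, (∀ j, ¬ H.Adj v j) → ∃ K : SimpleGraph V, H ≤ K ∧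
        (∀ i j, K.Adj i j ↔ H.Adj i j ∨ (i = v ∧ G.Adj v j) ∨ (j = v ∧ G.Adj v i)) := by
      intro H hH
      refine ⟨⟨fun i j => H.Adj i j ∨ (i = v ∧ G.Adj v j) ∨ (j = v ∧ G.Adj v i), ⟨?_⟩, ⟨?_⟩⟩,
        fun i j h => Or.inl h, fun i j => Iff.rfl⟩
      · rintro i j (h | h | h)
        exacts [Or.inl h.symm, Or.inr (Or.inr h), Or.inr (Or.inl h)]
      · rintro i (h | ⟨rfl, h⟩ | ⟨rfl, h⟩)
        exacts [h.ne rfl, h.ne rfl, h.ne rfl]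
    -- Restoring `v` adds the same amount to each degree whatever `H` is, so equal degrees in `G₁`
    -- and `G₂` give equal degrees in `G` and `K`.
    have hdeg : ∀ H K : SimpleGraph V, (∀ j, ¬ H.Adj v j) →
        (∀ i j, K.Adj i j ↔ H.Adj i j ∨ (i = v ∧ G.Adj v j) ∨ (j = v ∧ G.Adj v i)) →
        ∀ i, (K.neighborSet i).ncard = if i = v then (G.neighborSet v).ncard else
          (H.neighborSet i).ncard + if G.Adj v i then 1 else 0 := by
      intro H K hH hK i
      split_ifs with hi h
      · congr 1
        ext j
        simp [hK, hi, hH]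
      · rw [← Set.ncard_insert_of_notMem (a := v)]
        · congr 1
          ext j
          simp [hK, hi, h, or_comm]
        · simpa using fun h => hH i h.symm
      · rw [add_zero]
        congr 1
        ext j
        simp [hK, hi, h]
    have hv₁ : ∀ j, ¬ G₁.Adj v j := fun j h => ((hG₁ _ _).1 h).2.1 rfl
    have hdegG := hdeg G₁ G hv₁ fun i j => by
      rw [hG₁]
      have := G.adj_comm i j
      grind
    obtain ⟨G₂, hG₂, hgem⟩ := ih (S.erase v) (by omega) G₁ (fun i j h => by
        rw [hG₁] at h
        exact Finset.mem_erase.2 ⟨h.2.2, hG _ _ h.1⟩) (by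
        have h1 := Finset.add_sum_erase S (fun i => (G.neighborSet i).ncard) hv
        have h2 : ∑ i ∈ S.erase v, (G.neighborSet i).ncard = ∑ i ∈ S.erase v,
            (G₁.neighborSet i).ncard + ∑ i ∈ S.erase v, if G.Adj v i then 1 else 0 := by
          rw [← Finset.sum_add_distrib]
          refine Finset.sum_congr rfl fun i hi => ?_
          rw [hdegG, if_neg (Finset.ne_of_mem_erase hi)]
        rw [← ncard_neighborSet_eq_sum fun j h => Finset.mem_erase.2 ⟨h.ne', hG _ _ h⟩] at h2
        omega)
    have hv₂ : ∀ j, ¬ G₂.Adj v j := by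
      have h0 : (G₁.neighborSet v).ncard = 0 := by
        rw [Set.ncard_eq_zero]
        ext j
        simpa using hv₁ j
      rw [← hG₂, Set.ncard_eq_zero] at h0
      exact fun j h => (h0 ▸ h : j ∈ (∅ : Set V))
    obtain ⟨K, hle, hK⟩ := hjoin G₂ hv₂
    refine ⟨K, fun i => ?_, hgem.mono_right hle⟩
    rw [hdeg G₂ K hv₂ hK, hdegG i, hG₂]

theorem isPotentially_K5MinusP3_of_sum_ge {n : ℕ} (hn : 5 ≤ n) {d : Fin n → ℕ} (hd : IsGraphic d)
    (hsum : 4 * n - 4 ≤ ∑ i, d i) : IsPotentially K5MinusP3 d := by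
  obtain ⟨hanti, G, hG⟩ := hd
  obtain ⟨G', hG', hgem⟩ := exists_same_degrees_K5MinusP3_isContained (n - 5) univ
    (by simp; omega) G (fun _ _ _ => mem_univ _) (by
      simp only [Finset.card_univ, Fintype.card_fin]
      have : ∑ i, (G.neighborSet i).ncard = ∑ i, d i := Finset.sum_congr rfl fun i _ => hG i
      omega)
  exact ⟨hanti, G', fun i => (hG' i).trans (hG i), hgem⟩

/-! ### The extremal sequence -/

lemma extremalSeq_antitone {n : ℕ} (hn : 5 ≤ n) : Antitone (extremalSeq n) := by
  intro i j h
  have : (i : ℕ) ≤ j := h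
  simp only [extremalSeq]
  split_ifs <;> omega

lemma extremalSeq_isGraphic {n : ℕ} (hn : 5 ≤ n) : IsGraphic (extremalSeq n) := by
  refine ⟨extremalSeq_antitone hn,
    ⟨fun i j => i ≠ j ∧ ((i : ℕ) < 2 ∨ (j : ℕ) < 2), ⟨fun i j h => ⟨h.1.symm, h.2.symm⟩⟩,
      ⟨fun i h => h.1 rfl⟩⟩, fun i => ?_⟩
  simp only [extremalSeq]
  split_ifs with hi
  · have : {j : Fin n | i ≠ j ∧ ((i : ℕ) < 2 ∨ (j : ℕ) < 2)} = {i}ᶜ := by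
      ext j
      simp [hi, eq_comm]
    refine (congrArg Set.ncard this).trans ?_
    rw [Set.ncard_compl, Set.ncard_singleton, Nat.card_fin]
  · have : {j : Fin n | i ≠ j ∧ ((i : ℕ) < 2 ∨ (j : ℕ) < 2)} =
        {⟨0, by omega⟩, ⟨1, by omega⟩} := by
      ext j
      simp only [Set.mem_ofPred_eq, Set.mem_insert_iff, Set.mem_singleton_iff, Fin.ext_iff, ne_eq]
      omega
    refine (congrArg Set.ncard this).trans ?_
    exact Set.ncard_pair (by simp)

lemma extremalSeq_pos {n : ℕ} (hn : 5 ≤ n) (i : Fin n) : 0 < extremalSeq n i := by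
  simp only [extremalSeq]
  split_ifs <;> omega

lemma sum_extremalSeq {n : ℕ} (hn : 5 ≤ n) : ∑ i, extremalSeq n i = 4 * n - 6 := by
  obtain ⟨m, rfl⟩ := Nat.exists_eq_add_of_le' (show 2 ≤ n by omega)
  rw [Fin.sum_univ_succ, Fin.sum_univ_succ]
  simp [extremalSeq]
  omega

/-- The two vertices of degree `n - 1` are adjacent to everything, which exhausts the degree 2 of
every other vertex; hence they meet every edge. Covering the gem takes the hub and two path
vertices, or else all four path vertices. -/
lemma not_isPotentially_extremalSeq {n : ℕ} (hn : 5 ≤ n) :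
    ¬ IsPotentially K5MinusP3 (extremalSeq n) := by
  rintro ⟨-, G, hG, ⟨f⟩⟩
  have hdom : ∀ i j : Fin n, (i : ℕ) < 2 → i ≠ j → G.Adj i j := by
    intro i j hi hij
    have h1 : G.neighborSet i = {i}ᶜ := by
      refine Set.eq_of_subset_of_ncard_le (fun j h => ?_) ?_
      · simpa using (SimpleGraph.Adj.ne' h)
      · rw [hG, Set.ncard_compl, Set.ncard_singleton, Nat.card_fin]
        simp [extremalSeq, hi]
    have : j ∈ G.neighborSet i := by
      rw [h1]
      simpa using hij.symm
    exact this
  have hcover : ∀ i j : Fin n, G.Adj i j → (i : ℕ) < 2 ∨ (j : ℕ) < 2 := by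
    intro i j hij
    by_contra! h
    have h1 : ({⟨0, by omega⟩, ⟨1, by omega⟩} : Set (Fin n)) = G.neighborSet i := by
      refine Set.eq_of_subset_of_ncard_le ?_ ?_
      · rintro k (rfl | rfl)
        · exact (hdom _ _ (by simp) (by simp [Fin.ext_iff]; omega)).symm
        · exact (hdom _ _ (by simp) (by simp [Fin.ext_iff]; omega)).symm
      · rw [hG, Set.ncard_pair (by simp)]
        simp only [extremalSeq]
        rw [if_neg (by omega)]
    have h2 : j ∈ G.neighborSet i := hij
    rw [← h1] at h2
    simp only [Set.mem_insert_iff, Set.mem_singleton_iff, Fin.ext_iff] at h2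
    omega
  have hadj : ∀ i j : Fin 5, K5MinusP3.Adj i j → (f i : ℕ) < 2 ∨ (f j : ℕ) < 2 := fun i j h =>
    hcover _ _ (f.toHom.map_adj h)
  have hinj : ∀ i j : Fin 5, i ≠ j → (f i : ℕ) ≠ f j := fun i j h h' =>
    h (f.injective (Fin.ext h'))
  have a20 := hadj 2 0 (K5MinusP3_adj.2 (by decide))
  have a03 := hadj 0 3 (K5MinusP3_adj.2 (by decide))
  have a31 := hadj 3 1 (K5MinusP3_adj.2 (by decide))
  have a40 := hadj 4 0 (K5MinusP3_adj.2 (by decide))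
  have a41 := hadj 4 1 (K5MinusP3_adj.2 (by decide))
  have a42 := hadj 4 2 (K5MinusP3_adj.2 (by decide))
  have a43 := hadj 4 3 (K5MinusP3_adj.2 (by decide))
  have n01 := hinj 0 1 (by decide)
  have n02 := hinj 0 2 (by decide)
  have n03 := hinj 0 3 (by decide)
  have n04 := hinj 0 4 (by decide)
  have n12 := hinj 1 2 (by decide)
  have n13 := hinj 1 3 (by decide)
  have n14 := hinj 1 4 (by decide)
  have n23 := hinj 2 3 (by decide)
  have n24 := hinj 2 4 (by decide)
  have n34 := hinj 3 4 (by decide)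
  omega

end PotentiallyGraphic

theorem theorem4p1 (n : ℕ) (hn : 5 ≤ n) :
    PotentiallyGraphic.IsSigma PotentiallyGraphic.K5MinusP3 n (4 * n - 4) ∧
    (∀ d : Fin n → ℕ, PotentiallyGraphic.IsGraphic d → 4 * n - 4 ≤ ∑ i, d i →
      PotentiallyGraphic.IsPotentially PotentiallyGraphic.K5MinusP3 d) ∧
    (PotentiallyGraphic.IsGraphic (PotentiallyGraphic.extremalSeq n) ∧
      (∀ i, 0 < PotentiallyGraphic.extremalSeq n i) ∧
      ∑ i, PotentiallyGraphic.extremalSeq n i = 4 * n - 6 ∧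
      ¬ PotentiallyGraphic.IsPotentially PotentiallyGraphic.K5MinusP3
        (PotentiallyGraphic.extremalSeq n)) := by
  have hext := PotentiallyGraphic.extremalSeq_isGraphic hn
  have hpos := PotentiallyGraphic.extremalSeq_pos hn
  have hsum := PotentiallyGraphic.sum_extremalSeq hn
  have hnot := PotentiallyGraphic.not_isPotentially_extremalSeq hn
  refine ⟨⟨⟨⟨2 * n - 2, by omega⟩, fun d hd _ h =>
    PotentiallyGraphic.isPotentially_K5MinusP3_of_sum_ge hn hd h⟩, ?_⟩,
    fun d hd h => PotentiallyGraphic.isPotentially_K5MinusP3_of_sum_ge hn hd h,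
    hext, hpos, hsum, hnot⟩
  rintro l ⟨⟨k, hk⟩, hl⟩
  by_contra! hlt
  -- As `l` is even, `l < 4 * n - 4` gives `l ≤ 4 * n - 6`, the sum of the extremal sequence.
  exact hnot (hl _ hext hpos (by omega))
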